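/- **Conventions.** For a finite poset $P$ with least element $0$, $\ell(P)$ is the largest $n$ such that $P$ has an $(n+1)$-element chain, $\ell_P(x)=\ell([0,x])$, $A(P)$ is the set of atoms (elements covering $0$), and $A(x)=\{a\in A(P): a\le x\}$. Define $\mathfrak I_P(x)\subseteq\mathcal P(A(P))$ recursively by $\mathfrak I_P(x)=\{\emptyset\}$ if $\ell_P(x)=0$ and, otherwise, $\mathfrak I_P(x)=\{S\cup\{a\}: y\prec x,\ \ell_P(x)=\ell_P(y)+1,\ S\in\mathfrak I_P(y),\ a\in A(x)\setminus A(y)\}$. Put $\varphi_P(i)=\{x:\ell_P(x)=i\}$ and $\phi_P(i)=\bigcup_{\ell_P(x)=i}\mathfrak I_P(x)$. Families of sets are ordered by inclusion. For a family $\mathcal O$ and a set $X$, $\overline{X_{\mathcal O}}$ is the join in $\mathcal O$ of the atoms of $\mathcal O$ that are contained in $X$; an assertion about $\overline{X_{\mathcal O}}$ includes that this join exists. Let $L$ be a finite nonempty (upper) semimodular lattice and $m=\ell(L)$. Let $H(L)$ be the set of elements of $L$ that are neither $0$ nor an atom. A *finite extending standard form* of $L$ is a poset $P=L\cup\bigcup_{x\in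 H(L)}\Delta(x)$, where the $\Delta(x)$ are finite sets, disjoint from $L$ and from one another, $\Delta(x)\ne\emptyset$ if $x\in H(L)$ is join-irreducible, and the order of $L$ is extended by $0\prec x'\prec x$ for all $x'\in\Delta(x)$. Put $\mathcal S_P=\{A(x):x\in P\}$, where $A(P)$ is identified with (labelled by) a finite ground set $\Omega$; thus $\mathcal S_P$ is a family of subsets of $\Omega$. **Algorithm 1** (nondeterministic in the choice of $U$ and $W$). Start with $\mathcal Q=\emptyset$, $\mathcal R=\mathcal S_P$, $k=3$, $t=0$. * *Step 1.* $\mathcal Q:=\mathcal R$, $t:=k$. If some $X\in\varphi_{\mathcal Q}(k)$ has a proper subset $U$ such that (i1) $\overline{Y_{\mathcal R}}\subseteq U$ whenever $V\in\varphi_{\mathcal Q}(t-1)$ and $Y\subseteq U\cap V$; (i2) $\bigcup\sigma\nsubseteq U$ for all $\sigma\in\phi_{\mathcal Q}(k-1)$; (i3) $U\nsubseteq V$ for all $V\in\varphi_{\mathcal Q}(k-1)$; then choose such a $U$, put $\mathcal Q:=\mathcal Q\cup\{U\}$, and go to Step 2. Otherwise $k:=k+1$; if $k\ge m+1$ go to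 Step 5, else go to Step 1. * *Step 2.* If $\ell_{\mathcal Q}(U)=k-1$, put $k:=3$, $\mathcal R:=\mathcal Q$ and go to Step 1. Otherwise go to Step 3. * *Step 3.* If $U$ has a proper subset $W$ such that (j1) $\overline{Y_{\mathcal R}}\subseteq W$ whenever $V\in\varphi_{\mathcal Q}(t-1)$ and $Y\subseteq W\cap V$; (j2) $\bigcup\sigma\nsubseteq W$ for all $\sigma\in\phi_{\mathcal Q}(k-2)$; (j3) $W\nsubseteq V$ for all $V\in\varphi_{\mathcal Q}(k-2)$; then choose such a $W$, put $\mathcal Q:=\mathcal Q\cup\{W\}$, and go to Step 4. Otherwise go to Step 1. * *Step 4.* If $\ell_{\mathcal Q}(W)=k-2$, put $k:=3$, $\mathcal R:=\mathcal Q$ and go to Step 1. Otherwise $k:=k-1$ and go to Step 3. * *Step 5.* Stop and return $\mathcal Q$. Let $\mathfrak S$ be the set of all families of subsets of $\Omega$ that are returned by some terminating run of Algorithm 1 for some finite extending standard form $P$ of $L$ and some labelling of $A(P)$ by $\Omega$. Let $\overline{\mathfrak S}$ be the set of those $\mathcal Q\in\mathfrak S$ that satisfy $(\mathfrak M)$: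 if $k\ge 1$ and $X\in\varphi_{\mathcal Q}(k)$, then $\ell_{\mathcal Q}\bigl(\overline{(X\cup R)_{\mathcal Q}}\bigr)=k+1$ for every $R\in A(\mathcal Q)\setminus A(X)$. **Lemma.** Let $L$ be a finite nonempty semimodular lattice and $\Omega$ a finite set. Let $\mathcal Q$ be a family of subsets of $\Omega$ that contains $\emptyset$ and all singletons $\{a\}$, $a\in\Omega$ (so that these singletons are its atoms), and such that $(\mathcal Q,\subseteq)$ is a geometric lattice (a finite semimodular atomistic lattice). Suppose that $L$ is isomorphic to a cover-preserving sublattice of $\mathcal Q$ and that $\ell(L)=\ell(\mathcal Q)$. Then $\mathcal Q\in\overline{\mathfrak S}$; that is, $\mathcal Q$ satisfies $(\mathfrak M)$ and is an output of Algorithm 1 for some finite extending standard form of $L$. -/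

import Mathlib

universe u v

namespace GeomExt

/-! ### Partially ordered sets: atoms, levels, independent function

The length `ℓ(P)` of a partially ordered set is `Order.krullDim P`, the supremum of the numbers `n`
such that `P` has an `(n+1)`-element chain. If `P` has a least element, then `Order.height x` is the
length `ℓ_P(x)` of the interval `[0, x]`. -/

section Poset

variable (P : Type u) [PartialOrder P]

/-- The atoms of `P`: the elements that cover the least element. -/
def atoms : Set P := {a | ∃ z : P, IsBot z ∧ z ⋖ a}

variable {P}

/-- `A(x)`, the atoms of `P` below `x`. -/
def atomsBelow (x : P) : Set P := {a | a ∈ atoms P ∧ a ≤ x}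

/-- `σ ∈ 𝔍_P(x)`, where `𝔍_P` is the independent function of `P`. -/
inductive MemIndep : P → Set P → Prop
  | bot (x : P) (hx : Order.height x = 0) : MemIndep x ∅
  | step (x y a : P) (S : Set P) (hx : 1 ≤ Order.height x) (hS : MemIndep y S)
      (ha : a ∈ atomsBelow x \ atomsBelow y) (hh : Order.height x = Order.height y + 1)
      (hc : y ⋖ x) : MemIndep x (S ∪ {a})

variable (P)

/-- Any two elements have a join and a meet. -/
def IsLatticeOrder : Prop :=
  ∀ a b : P, (∃ s, IsLUB {a, b} s) ∧ (∃ i, IsGLB {a, b} i)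

/-- Semimodularity: `a ≺ b` implies `a ∨ c ≼ b ∨ c`. -/
def IsSemimodularOrder : Prop :=
  ∀ a b c s s' : P, a ⋖ b → IsLUB {a, c} s → IsLUB {b, c} s' → s ⩿ s'

/-- Every element is the join of the atoms below it. -/
def IsAtomisticOrder : Prop := ∀ x : P, IsLUB (atomsBelow x) x

/-- A finite geometric lattice: a finite semimodular atomistic lattice. -/
structure IsFiniteGeometric : Prop where
  nonempty : Nonempty P
  finite : Finite P
  lattice : IsLatticeOrder P
  semimodular : IsSemimodularOrder P
  atomistic : IsAtomisticOrder P

/-- `L ↪^≺ P`: up to isomorphism, the lattice `L` is a cover-preserving sublattice of `P`. -/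
def CoverPreservingEmbeds (L : Type v) [Lattice L] : Prop :=
  ∃ f : L → P, Function.Injective f ∧
    (∀ a b, IsLUB {f a, f b} (f (a ⊔ b))) ∧
    (∀ a b, IsGLB {f a, f b} (f (a ⊓ b))) ∧
    (∀ a b, a ⋖ b → f a ⋖ f b)

variable {P}

/-- The set representation `𝒮_P = {A(x) : x ∈ P}`, the atoms of `P` being labelled by `Ω`. -/
def setRep {Ω : Type v} (e : atoms P ≃ Ω) : Set (Set Ω) :=
  {S | ∃ x : P, S = e '' {a | (a : P) ≤ x}}

end Poset

/-! ### Extending standard forms of a lattice -/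

section StandardForm

variable (L : Type u) [Lattice L]

/-- `H(L)`: the elements of `L` that are neither an atom nor the least element. -/
def high : Set L := {x | x ∉ atoms L ∧ ¬ IsBot x}

variable {L}

/-- The disjoint union of `L` and of the sets `Δ(x)`, `x ∈ H(L)`. -/
inductive Ext (Δ : high L → Type v) : Type (max u v)
  | old (a : L) : Ext Δ
  | new (x : high L) (d : Δ x) : Ext Δ

/-- The order of `L` extended by `0 ≺ x' ≺ x` for all `x' ∈ Δ(x)`. -/
inductive Ext.Le (Δ : high L → Type v) : Ext Δ → Ext Δ → Prop
  | old_old (a b : L) (h : a ≤ b) : Ext.Le Δ (.old a) (.old b)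
  | new_old (x : high L) (d : Δ x) (b : L) (h : (x : L) ≤ b) : Ext.Le Δ (.new x d) (.old b)
  | bot_new (a : L) (ha : IsBot a) (x : high L) (d : Δ x) : Ext.Le Δ (.old a) (.new x d)
  | refl_new (x : high L) (d : Δ x) : Ext.Le Δ (.new x d) (.new x d)

instance (Δ : high L → Type v) : PartialOrder (Ext Δ) where
  le := Ext.Le Δ
  le_refl p := by
    cases p with
    | old a => exact .old_old a a le_rfl
    | new x d => exact .refl_new x d
  le_trans p q r hpq hqr := by
    cases hpq with
    | old_old a b h =>
      cases hqr with
      | old_old _ c h' => exact .old_old a c (h.trans h')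
      | bot_new _ hb x d => exact .bot_new a (fun y => h.trans (hb y)) x d
    | new_old x d b h =>
      cases hqr with
      | old_old _ c h' => exact .new_old x d c (h.trans h')
      | bot_new _ hb y d' => exact absurd (fun z => h.trans (hb z)) x.2.2
    | bot_new a ha x d =>
      cases hqr with
      | new_old _ _ b h => exact .old_old a b (ha b)
      | refl_new _ _ => exact .bot_new a ha x d
    | refl_new x d => exact hqr
  le_antisymm p q hpq hqp := by
    cases hpq with
    | old_old a b h =>
      cases hqp with
      | old_old _ _ h' => rw [le_antisymm h h']
    | new_old x d b h =>
      cases hqp with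
      | bot_new _ hb _ _ => exact absurd (fun z => h.trans (hb z)) x.2.2
    | bot_new a ha x d =>
      cases hqp with
      | new_old _ _ _ h => exact absurd (fun z => h.trans (ha z)) x.2.2
    | refl_new x d => rfl

variable (L)

/-- A finite extending standard form of `L`, given by the finite sets `Δ(x)`, `x ∈ H(L)`, with
`Δ(x) ≠ ∅` whenever `x` is join-irreducible. -/
structure StandardForm where
  Δ : high L → Type v
  finite : ∀ x, Finite (Δ x)
  nonempty : ∀ x : high L, SupIrred (x : L) → Nonempty (Δ x)

variable {L}

/-- The underlying partially ordered set `P = L ∪ ⋃ Δ(x)`. -/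
abbrev StandardForm.Carrier (F : StandardForm.{u, v} L) : Type (max u v) := Ext F.Δ

end StandardForm

/-! ### Families of sets, ordered by inclusion -/

section Family

variable {Ω : Type v}

/-- `φ_𝒬(k)` for a family `𝒬`: the members `X` of `𝒬` with `ℓ_𝒬(X) = k`. -/
def level (𝒬 : Set (Set Ω)) (k : ℕ) : Set (Set Ω) :=
  {X | ∃ h : X ∈ 𝒬, Order.height (⟨X, h⟩ : 𝒬) = k}

/-- The sets of atoms `σ ∈ 𝔍_𝒬(X)` with `X ∈ 𝒬` and `ℓ_𝒬(X) = k`. -/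
def indepLevel (𝒬 : Set (Set Ω)) (k : ℕ) : Set (Set 𝒬) :=
  {σ | ∃ X : 𝒬, Order.height X = k ∧ MemIndep X σ}

/-- `Z` is the closure of `X` in `𝒪`, i.e. the join in `(𝒪, ⊆)` of the atoms of `𝒪` that are
contained in `X`. -/
def IsClosureOf (𝒪 : Set (Set Ω)) (X : Set Ω) (Z : 𝒪) : Prop :=
  IsLUB {T : 𝒪 | T ∈ atoms 𝒪 ∧ (T : Set Ω) ⊆ X} Z

/-- The three conditions imposed on a candidate set `U`. Steps 1 and 3 of the algorithm use them
with `j = k - 1` and `j = k - 2`, respectively. -/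
structure Admissible (𝒬 ℛ : Set (Set Ω)) (t j : ℕ) (U : Set Ω) : Prop where
  closed : ∀ V ∈ level 𝒬 (t - 1), ∀ Y ⊆ U ∩ V, ∃ Z : ℛ, IsClosureOf ℛ Y Z ∧ (Z : Set Ω) ⊆ U
  indep : ∀ σ ∈ indepLevel 𝒬 j, ¬ (⋃ T ∈ σ, (T : Set Ω)) ⊆ U
  not_subset : ∀ V ∈ level 𝒬 j, ¬ U ⊆ V

/-! ### The algorithm -/

/-- The step that is to be executed next, with the sets it refers to. -/
inductive Control (Ω : Type v) : Type v
  | step1 : Control Ω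
  | step2 (U : Set Ω) : Control Ω
  | step3 (U : Set Ω) : Control Ω
  | step4 (U W : Set Ω) : Control Ω
  | halt : Control Ω

/-- A state of the algorithm: the next step and the values of the variables `𝒬, ℛ, k, t`. -/
structure State (Ω : Type v) : Type v where
  next : Control Ω
  Q : Set (Set Ω)
  R : Set (Set Ω)
  k : ℕ
  t : ℕ

/-- A set `U` that may be chosen in Step 1, where `𝒬 = ℛ` and `t = k`. -/
def Choice1 (ℛ : Set (Set Ω)) (k : ℕ) (U : Set Ω) : Prop :=
  (∃ X ∈ level ℛ k, U ⊂ X) ∧ Admissible ℛ ℛ k (k - 1) U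

/-- A set `W` that may be chosen in Step 3. -/
def Choice3 (𝒬 ℛ : Set (Set Ω)) (k t : ℕ) (U W : Set Ω) : Prop :=
  W ⊂ U ∧ Admissible 𝒬 ℛ t (k - 2) W

/-- One move of the (nondeterministic) algorithm. -/
inductive Move (m : ℕ) : State Ω → State Ω → Prop
  | step1_add (Q R : Set (Set Ω)) (k t : ℕ) (U : Set Ω) (hU : Choice1 R k U) :
      Move m ⟨.step1, Q, R, k, t⟩ ⟨.step2 U, R ∪ {U}, R, k, k⟩
  | step1_next (Q R : Set (Set Ω)) (k t : ℕ) (hU : ¬ ∃ U, Choice1 R k U) (hk : ¬ m + 1 ≤ k + 1) :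
      Move m ⟨.step1, Q, R, k, t⟩ ⟨.step1, R, R, k + 1, k⟩
  | step1_stop (Q R : Set (Set Ω)) (k t : ℕ) (hU : ¬ ∃ U, Choice1 R k U) (hk : m + 1 ≤ k + 1) :
      Move m ⟨.step1, Q, R, k, t⟩ ⟨.halt, R, R, k + 1, k⟩
  | step2_accept (Q R : Set (Set Ω)) (k t : ℕ) (U : Set Ω) (hU : U ∈ level Q (k - 1)) :
      Move m ⟨.step2 U, Q, R, k, t⟩ ⟨.step1, Q, Q, 3, t⟩
  | step2_descend (Q R : Set (Set Ω)) (k t : ℕ) (U : Set Ω) (hU : U ∉ level Q (k - 1)) :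
      Move m ⟨.step2 U, Q, R, k, t⟩ ⟨.step3 U, Q, R, k, t⟩
  | step3_add (Q R : Set (Set Ω)) (k t : ℕ) (U W : Set Ω) (hW : Choice3 Q R k t U W) :
      Move m ⟨.step3 U, Q, R, k, t⟩ ⟨.step4 U W, Q ∪ {W}, R, k, t⟩
  | step3_fail (Q R : Set (Set Ω)) (k t : ℕ) (U : Set Ω) (hW : ¬ ∃ W, Choice3 Q R k t U W) :
      Move m ⟨.step3 U, Q, R, k, t⟩ ⟨.step1, Q, R, k, t⟩
  | step4_accept (Q R : Set (Set Ω)) (k t : ℕ) (U W : Set Ω) (hW : W ∈ level Q (k - 2)) :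
      Move m ⟨.step4 U W, Q, R, k, t⟩ ⟨.step1, Q, Q, 3, t⟩
  | step4_descend (Q R : Set (Set Ω)) (k t : ℕ) (U W : Set Ω) (hW : W ∉ level Q (k - 2)) :
      Move m ⟨.step4 U W, Q, R, k, t⟩ ⟨.step3 U, Q, R, k - 1, t⟩

/-- Some run of the algorithm with parameter `m` and initial family `𝒮` stops and returns `𝒬`. -/
def Returns (m : ℕ) (𝒮 𝒬 : Set (Set Ω)) : Prop :=
  ∃ (R : Set (Set Ω)) (k t : ℕ),
    Relation.ReflTransGen (Move m) ⟨.step1, ∅, 𝒮, 3, 0⟩ ⟨.halt, 𝒬, R, k, t⟩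

/-- The condition `(𝔐)`: if `ℓ_𝒬(X) = k`, then the closure of `X ∪ R` has length `k + 1` for every
atom `R` of `𝒬` that is not below `X`. -/
def CondM (𝒬 : Set (Set Ω)) : Prop :=
  ∀ (k : ℕ) (X : 𝒬), 1 ≤ k → Order.height X = k → ∀ R ∈ atoms 𝒬 \ atomsBelow X,
    ∃ Z : 𝒬, IsClosureOf 𝒬 ((X : Set Ω) ∪ (R : Set Ω)) Z ∧ Order.height Z = (k : ℕ∞) + 1

end Family

section Outputs

variable (L : Type u) [Lattice L] (Ω : Type v)

/-- `𝔖`: the outputs of the algorithm for the input `m = ℓ(L)` and `𝒮_P`, where `P` is any finite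
extending standard form of `L` and `Ω` serves as the set of atoms of `P`. -/
def outputs : Set (Set (Set Ω)) :=
  {𝒬 | ∃ (F : StandardForm.{u, v} L) (e : atoms F.Carrier ≃ Ω) (m : ℕ),
    Order.krullDim L = m ∧ Returns m (setRep e) 𝒬}

/-- The outputs of the algorithm that satisfy `(𝔐)`. -/
def outputsM : Set (Set (Set Ω)) := {𝒬 | 𝒬 ∈ outputs L Ω ∧ CondM 𝒬}

end Outputs

end GeomExt

namespace GeomExt

/-! ### Saturated chains -/

section CoverChain

variable {α : Type u} [PartialOrder α]

/-! Since `L` and `𝒬` have the same length and covers are preserved, a maximal chain of `L` maps to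
a maximal chain of `𝒬`; hence `0` goes to `∅`, the top to `Ω`, and heights in `L` are ranks in `𝒬`.
Every point of `Ω` enters the image of `L` at a least element. Taking as `Δ(z)` the points that
enter at `z` gives a standard form whose representation is the image of `L` together with the
singletons (`exists_standardForm`).

From there a run is steered inside `𝒬`, keeping a subfamily `ℛ` whose ranks agree with those of `𝒬`.
If `ℛ ≠ 𝒬`, take the least `k` such that some `X ∈ ℛ` of rank `k` has a flat of `𝒬` below it missing
from `ℛ`. At smaller values of the counter Step 1 has no candidate (`not_choice1`), so the counter
reaches `k`. There, a hyperplane of `X` is missing, and one can be found that covers a member of `ℛ`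
(`exists_addable`). It is admissible (`admissible`) and has the right rank as soon as it is added
(`insert`), so Step 2 accepts it and Steps 3 and 4 are never entered. The number of missing flats
drops; when none is left, Step 1 finds nothing and the run halts with `𝒬`. Condition `(𝔐)` is the
unit rank increase on adjoining a point. -/

theorem height_ne_top_of_finite [Finite α] (x : α) : Order.height x ≠ ⊤ := by
  cases nonempty_fintype α
  intro h
  obtain ⟨p, -, hp⟩ := Order.height_eq_top_iff.1 h (Fintype.card α)
  exact (LTSeries.length_lt_card p).ne hp

/-- `b` is reached from `a` by a saturated chain of length `n`. -/
inductive CoverChain : ℕ → α → α → Prop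
  | refl (a : α) : CoverChain 0 a a
  | cons {a b c : α} {n : ℕ} (h : a ⋖ b) (hn : CoverChain n b c) : CoverChain (n + 1) a c

/-- Two elements that cover a common element are covered by a join. -/
def CoversJoin (α : Type u) [PartialOrder α] : Prop :=
  ∀ a b c : α, a ⋖ b → a ⋖ c → b ≠ c → ∃ d, b ⋖ d ∧ c ⋖ d ∧ ∀ y, b ≤ y → c ≤ y → d ≤ y

theorem CoverChain.le {n : ℕ} {a b : α} (h : CoverChain n a b) : a ≤ b := by
  induction h with
  | refl => exact le_rfl
  | cons h _ ih => exact h.le.trans ih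

theorem CoverChain.trans {n k : ℕ} {a b c : α} (h : CoverChain n a b) (h' : CoverChain k b c) :
    CoverChain (n + k) a c := by
  induction h with
  | refl => simpa using h'
  | cons h _ ih => rw [Nat.add_right_comm]; exact .cons h (ih h')

theorem CoverChain.snoc {n : ℕ} {a b c : α} (h : CoverChain n a b) (h' : b ⋖ c) :
    CoverChain (n + 1) a c :=
  h.trans (.cons h' (.refl c))

theorem CoverChain.map {β : Type v} [PartialOrder β] {f : α → β} (hf : ∀ a b, a ⋖ b → f a ⋖ f b)
    {n : ℕ} {a b : α} (h : CoverChain n a b) : CoverChain n (f a) (f b) := by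
  induction h with
  | refl => exact .refl _
  | cons h _ ih => exact .cons (hf _ _ h) ih

theorem CoverChain.eq_of_zero {a b : α} (h : CoverChain 0 a b) : a = b := by
  cases h; rfl

theorem exists_coverChain [Finite α] {a b : α} (h : a ≤ b) : ∃ n, CoverChain n a b := by
  induction a using WellFoundedGT.induction with
  | ind a ih =>
    rcases h.eq_or_lt with rfl | hlt
    · exact ⟨0, .refl _⟩
    · obtain ⟨c, hac, hcb⟩ := exists_covBy_le_of_lt hlt
      obtain ⟨n, hn⟩ := ih c hac.lt hcb
      exact ⟨n + 1, .cons hac hn⟩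

/-- The Jordan–Dedekind chain condition. -/
theorem CoverChain.unique [Finite α] (hα : CoversJoin α) {a y : α} {n k : ℕ}
    (h : CoverChain n a y) (h' : CoverChain k a y) : n = k := by
  induction a using WellFoundedGT.induction generalizing n k with
  | ind a ih =>
    cases h with
    | refl =>
      cases h' with
      | refl => rfl
      | cons hb hn => exact absurd hn.le hb.lt.not_ge
    | @cons _ b _ n hb hn =>
      cases h' with
      | refl => exact absurd hn.le hb.lt.not_ge
      | @cons _ c _ k hc hk =>
        by_cases hbc : b = c
        · subst hbc
          rw [ih b hb.lt hn hk]
        · obtain ⟨d, hbd, hcd, hd⟩ := hα a b c hb hc hbc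
          obtain ⟨p, hp⟩ := exists_coverChain (hd y hn.le hk.le)
          rw [ih b hb.lt hn (.cons hbd hp), ih c hc.lt hk (.cons hcd hp)]

theorem coverChain_of_height_eq [Finite α] {b : α} (hb : IsBot b) {n : ℕ} {x : α}
    (h : Order.height x = n) : CoverChain n b x := by
  induction n generalizing x with
  | zero =>
    have hx : IsMin x := Order.height_eq_zero.1 (by simpa using h)
    rw [hx.eq_of_le (hb x)]
    exact .refl _
  | succ n ih =>
    have h' : Order.height x = n + 1 := by rw [h]; push_cast; rfl
    obtain ⟨-, ⟨y, hyx, hy⟩, hmax⟩ := Order.height_eq_coe_add_one_iff.1 h'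
    refine (ih hy).snoc ⟨hyx, fun z hyz hzx => ?_⟩
    have h1 := Order.height_strictMono hyz (height_ne_top_of_finite y).lt_top
    exact absurd (hmax z hzx) (by rw [← hy]; exact not_le.2 h1)

theorem exists_height_eq [Finite α] (x : α) : ∃ n : ℕ, Order.height x = n :=
  ⟨_, (ENat.natCast_toNat (height_ne_top_of_finite x)).symm⟩

/-- The height is attained by some saturated chain, and the chain condition makes all of them
equally long; any one therefore computes the height. -/
theorem CoverChain.height_eq [Finite α] (hα : CoversJoin α) {b : α} (hb : IsBot b) {n : ℕ} {x : α}
    (h : CoverChain n b x) : Order.height x = n := by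
  obtain ⟨k, hk⟩ := exists_height_eq x
  rw [hk, h.unique hα (coverChain_of_height_eq hb hk)]

theorem isLUB_pair_of_le {a c : α} (h : a ≤ c) : IsLUB {a, c} c := by
  refine ⟨?_, fun w hw => hw (Set.mem_insert_of_mem _ rfl)⟩
  rintro w (rfl | rfl)
  · exact h
  · exact le_rfl

theorem IsSemimodularOrder.coversJoin (hs : IsSemimodularOrder α) (hl : IsLatticeOrder α) :
    CoversJoin α := by
  intro a b c hab hac hbc
  obtain ⟨⟨s, h1⟩, -⟩ := hl b c
  have h2 : IsLUB {c, b} s := by rwa [Set.pair_comm]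
  have hbs : b ≤ s := h1.1 (Set.mem_insert _ _)
  have hcs : c ≤ s := h2.1 (Set.mem_insert _ _)
  refine ⟨s, (hs a c b b s hac (isLUB_pair_of_le hab.le) h2).covBy_of_ne ?_,
    (hs a b c c s hab (isLUB_pair_of_le hac.le) h1).covBy_of_ne ?_, fun y hby hcy => h1.2 ?_⟩
  · rintro rfl
    exact hab.2 hac.lt (hcs.lt_of_ne' hbc)
  · rintro rfl
    exact hac.2 hab.lt (hbs.lt_of_ne hbc)
  · rintro w (rfl | rfl)
    · exact hby
    · exact hcy

end CoverChain

/-! ### Ranks in families of sets -/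

section Rank

variable {Ω : Type v}

open Classical in
/-- The length `ℓ_𝒬(X)` of a member `X` of a family `𝒬`. -/
noncomputable def rk (𝒬 : Set (Set Ω)) (X : Set Ω) : ℕ :=
  if h : X ∈ 𝒬 then (Order.height (⟨X, h⟩ : 𝒬)).toNat else 0

variable {𝒬 ℛ : Set (Set Ω)} {X Y : Set Ω}

theorem isBot_empty (h : ∅ ∈ 𝒬) : IsBot (⟨∅, h⟩ : 𝒬) := fun _ => Set.empty_subset _

theorem empty_covBy_singleton (h : ∅ ∈ 𝒬) {a : Ω} (ha : {a} ∈ 𝒬) :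
    (⟨∅, h⟩ : 𝒬) ⋖ ⟨{a}, ha⟩ := by
  refine ⟨Set.empty_ssubset_singleton, fun Z h1 h2 => ?_⟩
  have h2' : (Z : Set Ω) ⊂ {a} := h2
  rw [Set.ssubset_singleton_iff] at h2'
  have h1' : ∅ ⊂ (Z : Set Ω) := h1
  simp [h2'] at h1'

theorem mem_atoms_iff (h : ∅ ∈ 𝒬) (hs : ∀ a : Ω, {a} ∈ 𝒬) {T : 𝒬} :
    T ∈ atoms 𝒬 ↔ ∃ a, (T : Set Ω) = {a} := by
  constructor
  · rintro ⟨z, hz, hzT⟩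
    have hz0 : z = ⟨∅, h⟩ := le_antisymm (hz _) (isBot_empty h _)
    subst hz0
    obtain ⟨a, ha⟩ := Set.nonempty_of_ssubset' (show ∅ ⊂ (T : Set Ω) from hzT.lt)
    have hle : (⟨{a}, hs a⟩ : 𝒬) ≤ T := Set.singleton_subset_iff.2 ha
    rcases hle.eq_or_lt with he | hlt
    · exact ⟨a, by rw [← he]⟩
    · exact absurd hlt (hzT.2 (empty_covBy_singleton h (hs a)).lt)
  · rintro ⟨a, ha⟩
    refine ⟨⟨∅, h⟩, isBot_empty h, ?_⟩
    obtain ⟨T, hT⟩ := T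
    obtain rfl : T = {a} := ha
    exact empty_covBy_singleton h hT

variable [Finite Ω]

theorem height_eq_rk (X : 𝒬) : Order.height X = rk 𝒬 X := by
  rw [rk, dif_pos X.2, ENat.natCast_toNat (height_ne_top_of_finite _)]

theorem mem_level_iff {k : ℕ} : X ∈ level 𝒬 k ↔ X ∈ 𝒬 ∧ rk 𝒬 X = k := by
  simp only [level, Set.mem_ofPred_eq, height_eq_rk, Nat.cast_inj, exists_prop]

theorem rk_lt (hX : X ∈ 𝒬) (hY : Y ∈ 𝒬) (h : X ⊂ Y) : rk 𝒬 X < rk 𝒬 Y := by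
  have hlt : (⟨X, hX⟩ : 𝒬) < ⟨Y, hY⟩ := h
  have := Order.height_strictMono hlt (height_ne_top_of_finite _).lt_top
  simpa [height_eq_rk] using this

theorem exists_rk_eq {n : ℕ} (hX : X ∈ 𝒬) (h : n < rk 𝒬 X) : ∃ Y ∈ 𝒬, Y ⊂ X ∧ rk 𝒬 Y = n := by
  have h' : (n : ℕ∞) < Order.height (⟨X, hX⟩ : 𝒬) := by
    rw [height_eq_rk]; exact_mod_cast h
  obtain ⟨Y, hY, hn⟩ := (Order.coe_lt_height_iff (height_ne_top_of_finite _).lt_top).1 h'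
  exact ⟨Y, Y.2, hY, by simpa [height_eq_rk] using hn⟩

theorem rk_le_rk_of_subset (h : ℛ ⊆ 𝒬) (hX : X ∈ ℛ) : rk ℛ X ≤ rk 𝒬 X := by
  have := Order.height_le_height_apply_of_strictMono (Set.inclusion h)
    (fun _ _ hlt => hlt) ⟨X, hX⟩
  simpa [height_eq_rk] using this

theorem eq_of_subset_of_rk_le (hX : X ∈ 𝒬) (hY : Y ∈ 𝒬) (h : X ⊆ Y) (hr : rk 𝒬 Y ≤ rk 𝒬 X) :
    X = Y := by
  by_contra hne
  exact (rk_lt hX hY (h.ssubset_of_ne hne)).not_ge hr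

/-- The properties of the family of flats of a simple matroid that are used below. -/
structure IsFlatFamily (𝒬 : Set (Set Ω)) : Prop where
  empty_mem : ∅ ∈ 𝒬
  singleton_mem : ∀ a : Ω, {a} ∈ 𝒬
  univ_mem : Set.univ ∈ 𝒬
  inter_mem : ∀ U ∈ 𝒬, ∀ V ∈ 𝒬, U ∩ V ∈ 𝒬
  exists_adjoin : ∀ X ∈ 𝒬, ∀ a ∉ X, ∃ Y ∈ 𝒬, X ⊆ Y ∧ a ∈ Y ∧ rk 𝒬 Y = rk 𝒬 X + 1 ∧
    ∀ Z ∈ 𝒬, X ⊆ Z → a ∈ Z → Y ⊆ Z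

theorem rk_empty (h : ∅ ∈ 𝒬) : rk 𝒬 ∅ = 0 := by
  have : Order.height (⟨∅, h⟩ : 𝒬) = 0 := Order.height_eq_zero.2 fun _ _ => Set.empty_subset _
  simpa [height_eq_rk] using this

/-- Because all singletons belong to `𝒬`, meets are intersections and a maximal member absorbs every
point. Semimodularity applied to `∅ ⋖ {a}` shows that the join of `X` and `{a}` covers `X`. -/
theorem isFlatFamily (hempty : ∅ ∈ 𝒬) (hsingle : ∀ a : Ω, {a} ∈ 𝒬) (hgeom : IsFiniteGeometric 𝒬) :
    IsFlatFamily 𝒬 where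
  empty_mem := hempty
  singleton_mem := hsingle
  univ_mem := by
    obtain ⟨T, -, hT⟩ := (Set.toFinite (Set.univ : Set 𝒬)).exists_maximal ⟨⟨∅, hempty⟩, trivial⟩
    convert T.2
    refine (Set.eq_univ_of_forall fun a => ?_).symm
    obtain ⟨⟨Y, hY⟩, -⟩ := hgeom.lattice ⟨{a}, hsingle a⟩ T
    exact hT trivial (hY.1 (Set.mem_insert_of_mem _ rfl)) (hY.1 (Set.mem_insert _ _) rfl)
  inter_mem U hU V hV := by
    obtain ⟨-, ⟨Z, hZ⟩⟩ := hgeom.lattice ⟨U, hU⟩ ⟨V, hV⟩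
    convert Z.2
    refine Set.Subset.antisymm (fun a ha => ?_) (Set.subset_inter
      (hZ.1 (Set.mem_insert _ _)) (hZ.1 (Set.mem_insert_of_mem _ rfl)))
    have : (⟨{a}, hsingle a⟩ : 𝒬) ≤ Z := hZ.2 (by
      rintro W (rfl | rfl)
      · exact Set.singleton_subset_iff.2 ha.1
      · exact Set.singleton_subset_iff.2 ha.2)
    exact this rfl
  exists_adjoin X hX a ha := by
    obtain ⟨⟨Y, hY⟩, -⟩ := hgeom.lattice ⟨{a}, hsingle a⟩ ⟨X, hX⟩
    have haY : a ∈ (Y : Set Ω) := hY.1 (Set.mem_insert _ _) rfl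
    have hXY : X ⊆ Y := hY.1 (Set.mem_insert_of_mem _ rfl)
    have hXlub : IsLUB {(⟨∅, hempty⟩ : 𝒬), ⟨X, hX⟩} ⟨X, hX⟩ :=
      isLUB_pair_of_le (Set.empty_subset X)
    have hw := hgeom.semimodular _ _ _ _ _ (empty_covBy_singleton hempty (hsingle a)) hXlub hY
    have hcov : (⟨X, hX⟩ : 𝒬) ⋖ Y := hw.covBy_of_ne (by rintro rfl; exact ha haY)
    refine ⟨Y, Y.2, hXY, haY, ?_, fun Z hZ hXZ haZ => ?_⟩
    · have hc := coverChain_of_height_eq (isBot_empty hempty) (height_eq_rk (⟨X, hX⟩ : 𝒬))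
      have := (hc.snoc hcov).height_eq (hgeom.semimodular.coversJoin hgeom.lattice)
        (isBot_empty hempty)
      rw [height_eq_rk] at this
      exact_mod_cast this
    · refine hY.2 (show (⟨Z, hZ⟩ : 𝒬) ∈ _ from ?_)
      rintro W (rfl | rfl)
      · exact Set.singleton_subset_iff.2 haZ
      · exact hXZ

theorem IsFlatFamily.exists_coatom (h : IsFlatFamily 𝒬) (hX : X ∈ 𝒬) (hY : Y ∈ 𝒬) (hXY : X ⊂ Y) :
    ∃ H ∈ 𝒬, X ⊆ H ∧ H ⊂ Y ∧ rk 𝒬 Y = rk 𝒬 H + 1 := by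
  have hr := rk_lt hX hY hXY
  obtain ⟨n, hn⟩ : ∃ n, rk 𝒬 Y = rk 𝒬 X + 1 + n := Nat.exists_eq_add_of_le hr
  induction n generalizing X with
  | zero => exact ⟨X, hX, subset_rfl, hXY, hn⟩
  | succ n ih =>
    obtain ⟨a, haY, haX⟩ := Set.exists_of_ssubset hXY
    obtain ⟨Z, hZ, hXZ, -, hrZ, hmin⟩ := h.exists_adjoin X hX a haX
    have hZY : Z ⊂ Y := (hmin Y hY hXY.subset haY).ssubset_of_ne (by rintro rfl; lia)
    obtain ⟨H, hH, hZH, hHY⟩ := ih hZ hZY (rk_lt hZ hY hZY) (by lia)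
    exact ⟨H, hH, hXZ.trans hZH, hHY⟩

theorem condM_of_isFlatFamily (h : IsFlatFamily 𝒬) : CondM 𝒬 := by
  rintro k X - hk T ⟨hT, hTX⟩
  obtain ⟨a, ha⟩ := (mem_atoms_iff h.empty_mem h.singleton_mem).1 hT
  have haX : a ∉ (X : Set Ω) := fun hmem => hTX ⟨hT, by
    change (T : Set Ω) ⊆ X
    simpa [ha] using hmem⟩
  obtain ⟨Y, hY, hXY, haY, hr, hmin⟩ := h.exists_adjoin X X.2 a haX
  refine ⟨⟨Y, hY⟩, ⟨?_, fun Z hZ => ?_⟩, ?_⟩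
  · rintro S ⟨-, hS⟩
    refine hS.trans (Set.union_subset hXY ?_)
    simpa [ha] using haY
  · refine hmin Z Z.2 (fun b hb => ?_) ?_
    · have : (⟨{b}, h.singleton_mem b⟩ : 𝒬) ≤ Z :=
        hZ ⟨(mem_atoms_iff h.empty_mem h.singleton_mem).2 ⟨b, rfl⟩, by simp [hb]⟩
      exact this rfl
    · have : T ≤ Z := hZ ⟨hT, Set.subset_union_right⟩
      exact this (by simp [ha])
  · rw [height_eq_rk] at hk ⊢
    rw [hr, ← hk]
    simp

end Rank

/-! ### Runs of the algorithm inside a family of flats -/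

section Run

variable {Ω : Type v} {𝒬 ℛ : Set (Set Ω)} {X Y U V : Set Ω} {k m : ℕ}

/-- The bound is `max 3 m` because the counter starts at 3 even when `m < 3`, and it advances from
`k` only while `k < m`. -/
theorem reflTransGen_step1 (hk : 3 ≤ k) (hkm : k ≤ max 3 m)
    (hno : ∀ j < k, ¬ ∃ U, Choice1 ℛ j U) (Q : Set (Set Ω)) (t : ℕ) :
    ∃ Q' t', Relation.ReflTransGen (Move m) ⟨.step1, Q, ℛ, 3, t⟩ ⟨.step1, Q', ℛ, k, t'⟩ := by
  induction k, hk using Nat.le_induction with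
  | base => exact ⟨Q, t, .refl⟩
  | succ k hk ih =>
    obtain ⟨Q', t', hrun⟩ := ih (by lia) fun j hj => hno j (by lia)
    exact ⟨ℛ, k, hrun.tail (.step1_next Q' ℛ k t' (hno k (by lia)) (by lia))⟩

variable [Finite Ω]

/-- `ℛ` contains the trivial members of `𝒬`, and ranks in `ℛ` are those of `𝒬`. -/
structure IsRankedSubfamily (𝒬 ℛ : Set (Set Ω)) : Prop where
  subset : ℛ ⊆ 𝒬
  empty_mem : ∅ ∈ ℛ
  singleton_mem : ∀ a : Ω, {a} ∈ ℛ
  univ_mem : Set.univ ∈ ℛ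
  rk_eq : ∀ X ∈ ℛ, rk ℛ X = rk 𝒬 X

/-- Every member of `𝒬` below a member of `ℛ` of rank `k` is in `ℛ`. -/
def IsCompleteAt (𝒬 ℛ : Set (Set Ω)) (k : ℕ) : Prop :=
  ∀ X ∈ ℛ, rk 𝒬 X = k → ∀ Z ∈ 𝒬, Z ⊆ X → Z ∈ ℛ

theorem IsFlatFamily.exists_closure (h : IsFlatFamily 𝒬) (Y : Set Ω) :
    ∃ Z ∈ 𝒬, Y ⊆ Z ∧ ∀ W ∈ 𝒬, Y ⊆ W → Z ⊆ W := by
  obtain ⟨Z, ⟨hZ, hYZ⟩, hmin⟩ := (Set.toFinite {Z | Z ∈ 𝒬 ∧ Y ⊆ Z}).exists_minimal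
    ⟨Set.univ, h.univ_mem, Set.subset_univ _⟩
  refine ⟨Z, hZ, hYZ, fun W hW hYW => ?_⟩
  exact (hmin ⟨h.inter_mem Z hZ W hW, Set.subset_inter hYZ hYW⟩ Set.inter_subset_left).trans
    Set.inter_subset_right

/-- The closure of `Y` in `𝒬` lies below `V`, so completeness puts it in `ℛ`, where it is still the
least member containing `Y`. -/
theorem IsRankedSubfamily.exists_isClosureOf (hR : IsRankedSubfamily 𝒬 ℛ) (h : IsFlatFamily 𝒬)
    (hV : V ∈ ℛ) (hc : IsCompleteAt 𝒬 ℛ (rk 𝒬 V)) (hU : U ∈ 𝒬) (hY : Y ⊆ U ∩ V) :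
    ∃ Z : ℛ, IsClosureOf ℛ Y Z ∧ (Z : Set Ω) ⊆ U := by
  obtain ⟨Z, hZ, hYZ, hmin⟩ := h.exists_closure Y
  have hZV : Z ⊆ V := hmin V (hR.subset hV) (hY.trans Set.inter_subset_right)
  refine ⟨⟨Z, hc V hV rfl Z hZ hZV⟩, ⟨?_, fun W hW => hmin W (hR.subset W.2) fun a ha => ?_⟩,
    hmin U hU (hY.trans Set.inter_subset_left)⟩
  · rintro T ⟨-, hT⟩
    exact hT.trans hYZ
  · have : (⟨{a}, hR.singleton_mem a⟩ : ℛ) ≤ W :=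
      hW ⟨(mem_atoms_iff hR.empty_mem hR.singleton_mem).2 ⟨a, rfl⟩, by simpa using ha⟩
    exact this rfl

/-- An independent set spans its flat. In the induction, `U ∩ V` is a flat strictly above `W` and
inside `V`; since `V` has rank one more than `W`, it equals `V`. -/
theorem IsRankedSubfamily.subset_of_memIndep (hR : IsRankedSubfamily 𝒬 ℛ) (h : IsFlatFamily 𝒬)
    (hU : U ∈ 𝒬) {V : ℛ} {σ : Set ℛ} (hσ : MemIndep V σ) (hσU : (⋃ T ∈ σ, (T : Set Ω)) ⊆ U) :
    (V : Set Ω) ⊆ U := by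
  induction hσ with
  | bot V hV =>
    have : V ≤ ⟨∅, hR.empty_mem⟩ := Order.height_eq_zero.1 hV (Set.empty_subset _)
    exact Set.Subset.trans this (Set.empty_subset _)
  | step V W T S _ _ hT hr hc ih =>
    have hWU : (W : Set Ω) ⊆ U := ih ((Set.biUnion_mono Set.subset_union_left
      fun _ _ => subset_rfl).trans hσU)
    have hTU : (T : Set Ω) ⊆ U := (Set.subset_biUnion_of_mem
      (u := fun T : ℛ => (T : Set Ω)) (Set.mem_union_right S (Set.mem_singleton T))).trans hσU
    have hWV : (W : Set Ω) ⊆ V := hc.le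
    have hI := h.inter_mem U hU V (hR.subset V.2)
    have hWI : (W : Set Ω) ⊂ U ∩ V := (Set.subset_inter hWU hWV).ssubset_of_ne fun he =>
      hT.2 ⟨hT.1.1, show (T : Set Ω) ⊆ W from he ▸ Set.subset_inter hTU hT.1.2⟩
    have h1 := rk_lt (hR.subset W.2) hI hWI
    rw [height_eq_rk, height_eq_rk, hR.rk_eq _ V.2, hR.rk_eq _ W.2] at hr
    have hr' : rk 𝒬 (V : Set Ω) = rk 𝒬 W + 1 := by exact_mod_cast hr
    have := eq_of_subset_of_rk_le hI (hR.subset V.2) Set.inter_subset_right (by lia)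
    rw [← this]
    exact Set.inter_subset_left

/-- Failure of (i2) or (i3) would make `U` comparable with a member of `ℛ` of the same rank, hence
equal to it. Completeness at rank `k - 1` yields (i1). -/
theorem IsRankedSubfamily.admissible (hR : IsRankedSubfamily 𝒬 ℛ) (h : IsFlatFamily 𝒬)
    (hc : IsCompleteAt 𝒬 ℛ (k - 1)) (hU : U ∈ 𝒬) (hUR : U ∉ ℛ) (hr : rk 𝒬 U = k - 1) :
    Admissible ℛ ℛ k (k - 1) U where
  closed V hV Y hY := by
    rw [mem_level_iff] at hV
    rw [← hV.2, hR.rk_eq V hV.1] at hc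
    exact hR.exists_isClosureOf h hV.1 hc hU hY
  indep := by
    rintro σ ⟨V, hV, hσ⟩ hσU
    rw [height_eq_rk, hR.rk_eq _ V.2, Nat.cast_inj] at hV
    have := eq_of_subset_of_rk_le (hR.subset V.2) hU (hR.subset_of_memIndep h hU hσ hσU) (by lia)
    exact hUR (this ▸ V.2)
  not_subset V hV hUV := by
    rw [mem_level_iff] at hV
    rw [hR.rk_eq V hV.1] at hV
    have := eq_of_subset_of_rk_le hU (hR.subset hV.1) hUV (by lia)
    exact hUR (this ▸ hV.1)

/-- A subset of a flat `X` lies in a flat of rank `j` or contains an independent `j`-set. -/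
theorem IsRankedSubfamily.subset_or_memIndep (hR : IsRankedSubfamily 𝒬 ℛ) (h : IsFlatFamily 𝒬)
    (hX : X ∈ ℛ) (hc : IsCompleteAt 𝒬 ℛ (rk 𝒬 X)) (hUX : U ⊆ X) {j : ℕ} (hj : j ≤ rk 𝒬 X) :
    ∃ V : ℛ, (V : Set Ω) ⊆ X ∧ rk 𝒬 V = j ∧
      (U ⊆ V ∨ ∃ σ, MemIndep V σ ∧ (⋃ T ∈ σ, (T : Set Ω)) ⊆ U) := by
  induction j with
  | zero =>
    refine ⟨⟨∅, hR.empty_mem⟩, Set.empty_subset _, rk_empty h.empty_mem,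
      .inr ⟨∅, .bot _ ?_, by simp⟩⟩
    rw [height_eq_rk, rk_empty hR.empty_mem]
    rfl
  | succ j ih =>
    obtain ⟨V, hVX, hr, hV⟩ := ih (by lia)
    have hV𝒬 := hR.subset V.2
    have hVX' : (V : Set Ω) ⊂ X := hVX.ssubset_of_ne (by rintro rfl; lia)
    -- If `U` already lies in `V`, any flat of `X` one rank above `V` will do; otherwise a point of
    -- `U` outside `V` extends `σ`.
    by_cases hUV : U ⊆ V
    · obtain ⟨a, haX, haV⟩ := Set.exists_of_ssubset hVX'
      obtain ⟨W, hW, hVW, -, hrW, hmin⟩ := h.exists_adjoin V hV𝒬 a haV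
      have hWX := hmin X (hR.subset hX) hVX haX
      exact ⟨⟨W, hc X hX rfl W hW hWX⟩, hWX, by simp only; lia, .inl (hUV.trans hVW)⟩
    · obtain ⟨σ, hσ, hσU⟩ := hV.resolve_left hUV
      obtain ⟨a, haU, haV⟩ := Set.not_subset.1 hUV
      obtain ⟨W, hW, hVW, haW, hrW, hmin⟩ := h.exists_adjoin V hV𝒬 a haV
      have hWX := hmin X (hR.subset hX) hVX (hUX haU)
      have hWR := hc X hX rfl W hW hWX
      have hht : Order.height (⟨W, hWR⟩ : ℛ) = Order.height V + 1 := by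
        rw [height_eq_rk, height_eq_rk, hR.rk_eq _ V.2, hR.rk_eq _ hWR, hrW]
        simp
      refine ⟨⟨W, hWR⟩, hWX, by simp only; lia,
        .inr ⟨σ ∪ {⟨{a}, hR.singleton_mem a⟩}, .step _ V _ _ ?_ hσ ⟨⟨?_, ?_⟩, ?_⟩ hht ?_, ?_⟩⟩
      · rw [hht]
        exact le_add_self
      · exact (mem_atoms_iff hR.empty_mem hR.singleton_mem).2 ⟨a, rfl⟩
      · exact Set.singleton_subset_iff.2 haW
      · exact fun hmem => haV (hmem.2 rfl)
      · refine ⟨hVW.ssubset_of_ne (by rintro rfl; exact haV haW), fun Z h1 h2 => ?_⟩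
        have h1' := rk_lt V.2 Z.2 h1
        have h2' := rk_lt Z.2 hWR h2
        rw [hR.rk_eq _ V.2] at h1'
        rw [hR.rk_eq _ hWR] at h2'
        lia
      · rw [Set.biUnion_union]
        exact Set.union_subset hσU (by simpa using haU)

/-- Below a complete `X`, (i2) and (i3) exclude each other: a subset of `X` is contained in a flat
of rank `k - 1` or contains an independent set spanning one. -/
theorem IsRankedSubfamily.not_choice1 (hR : IsRankedSubfamily 𝒬 ℛ) (h : IsFlatFamily 𝒬)
    (hc : IsCompleteAt 𝒬 ℛ k) : ¬ ∃ U, Choice1 ℛ k U := by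
  rintro ⟨U, ⟨X, hX, hUX⟩, hU⟩
  rw [mem_level_iff] at hX
  obtain ⟨hX, hr⟩ := hX
  rw [hR.rk_eq X hX] at hr
  subst hr
  obtain ⟨V, -, hrV, hV | ⟨σ, hσ, hσU⟩⟩ :=
    hR.subset_or_memIndep h hX hc hUX.subset (Nat.sub_le _ 1)
  · exact hU.not_subset V (mem_level_iff.2 ⟨V.2, by rw [hR.rk_eq _ V.2, hrV]⟩) hV
  · exact hU.indep σ ⟨V, by rw [height_eq_rk, hR.rk_eq _ V.2, hrV], hσ⟩ hσU

/-- Hyperplanes of `X` are connected through their common hyperplanes: if `ℛ` contains some but not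
all hyperplanes of `X`, then one that is missing covers a member of `ℛ`. -/
theorem IsRankedSubfamily.exists_addable (hR : IsRankedSubfamily 𝒬 ℛ) (h : IsFlatFamily 𝒬)
    {n : ℕ} (hc : IsCompleteAt 𝒬 ℛ (n + 1)) (hX : X ∈ ℛ) (hXr : rk 𝒬 X = n + 2)
    (hU : ∃ U ∈ 𝒬, U ⊆ X ∧ rk 𝒬 U = n + 1 ∧ U ∉ ℛ) :
    ∃ U ∈ 𝒬, U ⊂ X ∧ rk 𝒬 U = n + 1 ∧ U ∉ ℛ ∧ ∃ F ∈ ℛ, F ⊂ U ∧ rk 𝒬 F = n := by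
  obtain ⟨H₀, hH₀, hH₀X, hH₀r⟩ := exists_rk_eq (n := n + 1) hX (by rw [hR.rk_eq X hX]; lia)
  rw [hR.rk_eq _ hH₀] at hH₀r
  obtain ⟨U₀, hU₀⟩ := hU
  -- Choose a present hyperplane `H` and a missing one `U` with the largest possible intersection.
  obtain ⟨⟨H, U⟩, ⟨⟨hH, hHX, hHr⟩, hU, hUX, hUr, hUR⟩, hmax⟩ :=
    Set.exists_max_image {p : Set Ω × Set Ω | (p.1 ∈ ℛ ∧ p.1 ⊆ X ∧ rk 𝒬 p.1 = n + 1) ∧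
      p.2 ∈ 𝒬 ∧ p.2 ⊆ X ∧ rk 𝒬 p.2 = n + 1 ∧ p.2 ∉ ℛ} (fun p => (p.1 ∩ p.2).ncard)
      (Set.toFinite _) ⟨⟨H₀, U₀⟩, ⟨hH₀, hH₀X.subset, hH₀r⟩, hU₀⟩
  have hne : H ≠ U := by rintro rfl; exact hUR hH
  have hH𝒬 := hR.subset hH
  have hIH : H ∩ U ⊂ H := Set.inter_subset_left.ssubset_of_ne fun he =>
    hne (eq_of_subset_of_rk_le hH𝒬 hU (Set.inter_eq_left.1 he) (by lia))
  obtain ⟨F, hF, hIF, hFH, hFr⟩ := h.exists_coatom (h.inter_mem H hH𝒬 U hU) hH𝒬 hIH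
  have hFR : F ∈ ℛ := hc H hH hHr F hF hFH.subset
  obtain ⟨a, haU, haH⟩ := Set.not_subset.1 fun hUH =>
    hne (eq_of_subset_of_rk_le hU hH𝒬 hUH (by lia)).symm
  have haF : a ∉ F := fun ha => haH (hFH.subset ha)
  obtain ⟨G, hG, hFG, haG, hGr, hmin⟩ := h.exists_adjoin F hF a haF
  have hGX : G ⊆ X := hmin X (hR.subset hX) (hFH.subset.trans hHX) (hUX haU)
  -- `G` is spanned by a hyperplane `F ⊇ H ∩ U` of `H` and a point of `U \ H`, so it meets `U` in
  -- more than `H` does. Maximality forbids `G ∈ ℛ`, and `G` covers `F ∈ ℛ`.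
  by_cases hGR : G ∈ ℛ
  · have hlt : (H ∩ U).ncard < (G ∩ U).ncard := by
      refine Set.ncard_lt_ncard ⟨Set.subset_inter (hIF.trans hFG) Set.inter_subset_right, ?_⟩
      exact fun hsub => haH (hsub ⟨haG, haU⟩).1
    exact absurd (hmax ⟨G, U⟩ ⟨⟨hGR, hGX, by simp only; lia⟩, hU, hUX, hUr, hUR⟩) (not_le.2 hlt)
  · exact ⟨G, hG, hGX.ssubset_of_ne (by rintro rfl; exact hGR hX), by lia, hGR, F, hFR,
      hFG.ssubset_of_ne (by rintro rfl; exact haF haG), by lia⟩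

/-- Adding a member of `𝒬` that covers a member of `ℛ` preserves the ranks. -/
theorem IsRankedSubfamily.insert (hR : IsRankedSubfamily 𝒬 ℛ) (hU : U ∈ 𝒬) {F : Set Ω}
    (hF : F ∈ ℛ) (hFU : F ⊂ U) (hr : rk 𝒬 U = rk 𝒬 F + 1) :
    IsRankedSubfamily 𝒬 (ℛ ∪ {U}) := by
  have hsub : ℛ ∪ {U} ⊆ 𝒬 := Set.union_subset hR.subset (Set.singleton_subset_iff.2 hU)
  -- Ranks grow with the family, so the new rank lies between the equal ranks in `ℛ` and `𝒬`.
  have hold : ∀ X ∈ ℛ, rk (ℛ ∪ {U}) X = rk 𝒬 X := fun X hX =>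
    (rk_le_rk_of_subset hsub (.inl hX)).antisymm
      ((hR.rk_eq X hX).symm.trans_le (rk_le_rk_of_subset Set.subset_union_left hX))
  refine ⟨hsub, .inl hR.empty_mem, fun a => .inl (hR.singleton_mem a), .inl hR.univ_mem, ?_⟩
  rintro X (hX | rfl)
  · exact hold X hX
  · refine (rk_le_rk_of_subset hsub (.inr rfl)).antisymm ?_
    rw [hr, ← hold F hF]
    exact rk_lt (.inl hF) (.inr rfl) hFU

theorem IsRankedSubfamily.exists_run (hR : IsRankedSubfamily 𝒬 ℛ) (h : IsFlatFamily 𝒬)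
    (hm : rk 𝒬 Set.univ = m) (Q : Set (Set Ω)) (t : ℕ) :
    ∃ R k t', Relation.ReflTransGen (Move m) ⟨.step1, Q, ℛ, 3, t⟩ ⟨.halt, 𝒬, R, k, t'⟩ := by
  obtain ⟨n, hn⟩ : ∃ n, (𝒬 \ ℛ).ncard = n := ⟨_, rfl⟩
  induction n using Nat.strong_induction_on generalizing ℛ Q t with
  | _ n ih =>
    by_cases hall : ∀ k, IsCompleteAt 𝒬 ℛ k
    · obtain rfl : ℛ = 𝒬 := hR.subset.antisymm fun Z hZ =>
        hall _ _ hR.univ_mem rfl Z hZ (Set.subset_univ Z)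
      obtain ⟨Q', t', hrun⟩ := reflTransGen_step1 (m := m) (le_max_left 3 m) le_rfl
        (fun j _ => hR.not_choice1 h (hall j)) Q t
      exact ⟨_, _, _, hrun.tail (Move.step1_stop Q' ℛ _ t' (hR.not_choice1 h (hall _)) (by lia))⟩
    · rw [not_forall] at hall
      classical
      obtain ⟨k, hk, hlow⟩ : ∃ k, ¬ IsCompleteAt 𝒬 ℛ k ∧ ∀ j < k, IsCompleteAt 𝒬 ℛ j :=
        ⟨Nat.find hall, Nat.find_spec hall, fun j hj => not_not.1 (Nat.find_min hall hj)⟩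
      simp only [IsCompleteAt, not_forall] at hk
      obtain ⟨X, hX, hXr, Z, hZ, hZX, hZR⟩ := hk
      have hX𝒬 := hR.subset hX
      obtain ⟨U, hU, hZU, hUX, hUr⟩ := h.exists_coatom hZ hX𝒬
        (hZX.ssubset_of_ne (by rintro rfl; exact hZR hX))
      -- Otherwise completeness at rank `k - 1` would already give `Z ∈ ℛ`.
      have hUR : U ∉ ℛ := fun hUR => hZR (hlow _ (by lia) U hUR rfl Z hZ hZU)
      -- The missing hyperplane is neither empty nor a singleton, so its rank `k - 1` is at least 2.
      have hk3 : 3 ≤ k := by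
        by_contra hlt
        have hU0 : U.Nonempty := by
          rw [Set.nonempty_iff_ne_empty]
          rintro rfl
          exact hUR hR.empty_mem
        obtain ⟨a, ha⟩ := hU0
        have haU : ({a} : Set Ω) ⊂ U := (Set.singleton_subset_iff.2 ha).ssubset_of_ne
          (by rintro rfl; exact hUR (hR.singleton_mem a))
        have h1 := rk_lt (h.singleton_mem a) hU haU
        have h2 := rk_lt h.empty_mem (h.singleton_mem a) (Set.empty_ssubset_singleton)
        lia
      have hkm : k ≤ m := by
        by_cases hXu : X = Set.univ
        · rw [← hXr, hXu, hm]
        · have := rk_lt hX𝒬 h.univ_mem ((Set.subset_univ X).ssubset_of_ne hXu)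
          lia
      obtain ⟨j, rfl⟩ : ∃ j, k = j + 2 := ⟨k - 2, by lia⟩
      obtain ⟨U, hU, hUX, hUr, hUR, F, hF, hFU, hFr⟩ := hR.exists_addable h (hlow _ (by lia)) hX hXr
        ⟨U, hU, hUX.subset, by lia, hUR⟩
      have hR' := hR.insert hU hF hFU (by lia)
      obtain ⟨Q', t', hrun⟩ := reflTransGen_step1 hk3 (hkm.trans (le_max_right 3 m))
        (fun j hj => hR.not_choice1 h (hlow j hj)) Q t
      have hchoice : Choice1 ℛ (j + 2) U :=
        ⟨⟨X, mem_level_iff.2 ⟨hX, by rw [hR.rk_eq X hX, hXr]⟩, hUX⟩,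
          hR.admissible h (hlow _ (by lia)) hU hUR (by lia)⟩
      have haccept : U ∈ level (ℛ ∪ {U}) (j + 2 - 1) :=
        mem_level_iff.2 ⟨.inr rfl, by rw [hR'.rk_eq U (.inr rfl)]; lia⟩
      obtain ⟨R, k', t'', hrun'⟩ := ih (𝒬 \ (ℛ ∪ {U})).ncard
        (hn ▸ Set.ncard_lt_ncard ⟨Set.sdiff_subset_sdiff_right Set.subset_union_left,
          fun hsub => (hsub ⟨hU, hUR⟩).2 (.inr rfl)⟩) hR' (ℛ ∪ {U}) (j + 2) rfl
      exact ⟨R, k', t'', ((hrun.tail (.step1_add Q' ℛ _ t' U hchoice)).tail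
        (.step2_accept _ ℛ _ _ U haccept)).trans hrun'⟩

end Run

/-! ### The standard form given by a cover-preserving sublattice -/

section Embedding

theorem Ext.old_le_old {L : Type u} [Lattice L] {Δ : high L → Type v} {a b : L} :
    (Ext.old a : Ext Δ) ≤ .old b ↔ a ≤ b :=
  ⟨fun h => by cases h; assumption, fun h => .old_old a b h⟩

theorem Ext.new_le_old {L : Type u} [Lattice L] {Δ : high L → Type v} {x : high L} {d : Δ x}
    {b : L} : (Ext.new x d : Ext Δ) ≤ .old b ↔ (x : L) ≤ b :=
  ⟨fun h => by cases h; assumption, fun h => .new_old x d b h⟩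

theorem Ext.isBot_old {L : Type u} [Lattice L] {Δ : high L → Type v} {b : L} (hb : IsBot b) :
    IsBot (Ext.old b : Ext Δ)
  | .old a => .old_old b a (hb a)
  | .new x d => .bot_new b hb x d

theorem Ext.old_covBy_new {L : Type u} [Lattice L] {Δ : high L → Type v} {b : L} (hb : IsBot b)
    (x : high L) (d : Δ x) : (Ext.old b : Ext Δ) ⋖ .new x d := by
  refine ⟨(Ext.isBot_old hb _).lt_of_ne (by simp), fun q h1 h2 => ?_⟩
  cases h2.le with
  | bot_new a ha => exact h1.not_ge (Ext.isBot_old ha _)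
  | refl_new => exact h2.false

theorem Ext.old_covBy_old {L : Type u} [Lattice L] {Δ : high L → Type v} {a b : L}
    (hb : IsBot b) : (Ext.old b : Ext Δ) ⋖ .old a ↔ b ⋖ a := by
  constructor
  · intro h
    refine ⟨(hb a).lt_of_not_ge fun hle => h.lt.not_ge (Ext.old_le_old.2 hle), fun c h1 h2 => ?_⟩
    refine h.2 (c := Ext.old c) ?_ ?_
    · exact lt_of_le_not_ge (Ext.old_le_old.2 h1.le) (fun hle => h1.not_ge (Ext.old_le_old.1 hle))
    · exact lt_of_le_not_ge (Ext.old_le_old.2 h2.le) (fun hle => h2.not_ge (Ext.old_le_old.1 hle))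
  · intro h
    refine ⟨lt_of_le_not_ge (Ext.old_le_old.2 h.le)
      (fun hle => h.lt.not_ge (Ext.old_le_old.1 hle)), fun q h1 h2 => ?_⟩
    cases q with
    | old c =>
      refine h.2 (c := c) ?_ ?_
      · exact lt_of_le_not_ge (hb c) (fun hle => h1.not_ge (Ext.old_le_old.2 hle))
      · exact lt_of_le_not_ge (Ext.old_le_old.1 h2.le)
          (fun hle => h2.not_ge (Ext.old_le_old.2 hle))
    | new x d =>
      have hxa : (x : L) ≤ a := Ext.new_le_old.1 h2.le
      have hbx : b < x := (hb x).lt_of_not_ge fun hle => x.2.2 fun y => hle.trans (hb y)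
      have hx : (x : L) = a := (hxa.eq_or_lt).resolve_right (h.2 hbx)
      exact x.2.1 ⟨b, hb, hx ▸ h⟩

variable {L : Type u} [Lattice L] [Finite L] {Ω : Type v}

/-- Each point of `Ω` that the isotone map `f` reaches is reached first at a least element. -/
theorem exists_isLeast {f : L → Set Ω} (hinf : ∀ a b, f (a ⊓ b) = f a ∩ f b) {t : L}
    (ht : f t = Set.univ) (a : Ω) : ∃ x, IsLeast {y | a ∈ f y} x := by
  obtain ⟨x, hx, hmin⟩ := (Set.toFinite {y | a ∈ f y}).exists_minimal ⟨t, by simp [ht]⟩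
  refine ⟨x, hx, fun y hy => ?_⟩
  have hxy : a ∈ f (x ⊓ y) := by rw [hinf]; exact ⟨hx, hy⟩
  exact (hmin hxy inf_le_left).trans inf_le_right

/-- A cover-preserving representation of `L` by subsets of `Ω` comes from a standard form of `L`
whose atoms are labelled by `Ω`. -/
theorem exists_standardForm [Finite Ω] {f : L → Set Ω} (hinj : Function.Injective f)
    (hinf : ∀ a b, f (a ⊓ b) = f a ∩ f b) {b t : L} (hb : IsBot b)
    (hfb : f b = ∅) (hft : f t = Set.univ) (hatom : ∀ a, b ⋖ a → ∃ c, f a = {c}) :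
    ∃ (F : StandardForm.{u, v} L) (e : atoms F.Carrier ≃ Ω),
      setRep e = Set.range f ∪ Set.range fun c => {c} := by
  classical
  choose x hx using exists_isLeast hinf hft
  have hmono : ∀ {y z}, y ≤ z → f y ⊆ f z := fun {y z} hyz =>
    Set.inter_eq_left.1 (by rw [← hinf, inf_eq_left.2 hyz])
  have hle : ∀ {c y}, x c ≤ y ↔ c ∈ f y := fun {c y} =>
    ⟨fun h => hmono h (hx c).1, fun h => (hx c).2 h⟩
  have hxb : ∀ c, b < x c := fun c => (hb _).lt_of_not_ge fun h => by
    simpa [hfb] using hle.1 h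
  have hcov : ∀ {c}, x c ∉ high L → b ⋖ x c := fun {c} h => by
    by_contra hbc
    refine h ⟨?_, fun hbot => (hxb c).not_ge (hbot b)⟩
    rintro ⟨z, hz, hzc⟩
    exact hbc ((hz b).antisymm (hb z) ▸ hzc)
  let F : StandardForm.{u, v} L :=
    { Δ := fun z => {c : Ω // x c = z}
      finite := fun z => inferInstance
      nonempty := by
        rintro ⟨z, hz⟩ hirr
        -- A point gained between a lower cover `y` and `z` must enter at `z`: entering at a smaller
        -- element would put that element below `y`, by irreducibility of `z`.
        obtain ⟨y, -, hyz⟩ := exists_le_covBy_of_lt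
          ((hb z).lt_of_not_ge fun h => hz.2 fun w => h.trans (hb w))
        obtain ⟨c, hcz, hcy⟩ := Set.exists_of_ssubset
          ((hmono hyz.le).ssubset_of_ne fun h => hyz.lt.ne (hinj h))
        refine ⟨c, (hle.2 hcz).eq_or_lt.resolve_right fun hlt => ?_⟩
        have hsup : y ⊔ x c < z := (sup_le hyz.le hlt.le).lt_of_ne fun h =>
          (hirr.2 h).elim hyz.lt.ne hlt.ne
        have : y = y ⊔ x c := le_sup_left.eq_or_lt.resolve_right fun h => hyz.2 h hsup
        exact hcy (hle.1 (this ▸ le_sup_right)) }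
  -- A point entering at an atom of `L` labels that atom; every other point labels its own new atom.
  let p : Ω → F.Carrier := fun c =>
    if h : x c ∈ high L then .new ⟨x c, h⟩ ⟨c, rfl⟩ else .old (x c)
  have hp : ∀ {c y}, p c ≤ .old y ↔ c ∈ f y := fun {c y} => by
    rw [← hle]
    by_cases h : x c ∈ high L
    · simp only [p, dif_pos h]; exact Ext.new_le_old
    · simp only [p, dif_neg h]; exact Ext.old_le_old
  have hpcov : ∀ c, (Ext.old b : F.Carrier) ⋖ p c := fun c => by
    by_cases h : x c ∈ high L
    · simp only [p, dif_pos h]; exact Ext.old_covBy_new hb _ _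
    · simp only [p, dif_neg h]; exact (Ext.old_covBy_old hb).2 (hcov h)
  have hpinj : Function.Injective p := fun c c' heq => by
    by_cases h : x c ∈ high L <;> by_cases h' : x c' ∈ high L <;>
      simp only [p, h, h', dite_true, dite_false] at heq
    -- A non-dependent projection recovers the point, avoiding an equality between different fibres
    -- of `Δ`.
    · have := congrArg (fun q : F.Carrier => match q with
        | .old _ => none
        | .new _ d => some d.1) heq
      simpa using this
    · cases heq
    · cases heq
    · have hxx : x c = x c' := by injection heq
      obtain ⟨d, hd⟩ := hatom _ (hcov h)
      have h1 : c ∈ f (x c) := (hx c).1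
      have h2 : c' ∈ f (x c) := hxx ▸ (hx c').1
      rw [hd] at h1 h2
      exact h1.trans h2.symm
  have hpnew : ∀ (z : high L) (d : F.Δ z), p d.1 = .new z d := by
    rintro ⟨z, hz⟩ ⟨c, hc⟩
    change x c = z at hc
    subst hc
    simp only [p, dif_pos hz]
  have hpsurj : ∀ q ∈ atoms F.Carrier, ∃ c, p c = q := by
    rintro q ⟨z, hz, hzq⟩
    obtain rfl : z = .old b := (hz _).antisymm (Ext.isBot_old hb z)
    cases q with
    | new z d => exact ⟨d.1, hpnew z d⟩
    | old a =>
      have hba := (Ext.old_covBy_old hb).1 hzq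
      obtain ⟨c, hc⟩ := hatom a hba
      have hxa : x c = a := (hle.2 (by rw [hc]; rfl)).eq_or_lt.resolve_right (hba.2 (hxb c))
      refine ⟨c, ?_⟩
      have hnot : x c ∉ high L := fun h => h.1 ⟨b, hb, hxa ▸ hba⟩
      simp only [p, dif_neg hnot, hxa]
  let e : Ω ≃ atoms F.Carrier := Equiv.ofBijective
    (fun c => ⟨p c, .old b, Ext.isBot_old hb, hpcov c⟩)
    ⟨fun c c' h => hpinj (congrArg Subtype.val h),
      fun q => (hpsurj q q.2).imp fun c hc => Subtype.ext hc⟩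
  have hrep : ∀ q : F.Carrier, e.symm '' {a | (a : F.Carrier) ≤ q} = {c | p c ≤ q} := fun q => by
    rw [Equiv.image_symm_eq_preimage]
    rfl
  have hold : ∀ y, {c | p c ≤ .old y} = f y := fun y => Set.ext fun c => hp
  have hpoint : ∀ c, {c' | p c' ≤ p c} = {c} := fun c => Set.ext fun c' =>
    ⟨fun h => hpinj ((le_iff_eq_or_lt.1 h).resolve_right ((hpcov c).2 (hpcov c').lt)),
      fun h => (congrArg p h).le⟩
  refine ⟨F, e.symm, Set.ext fun S => ⟨?_, ?_⟩⟩
  · rintro ⟨q, rfl⟩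
    rw [hrep]
    cases q with
    | old y => exact .inl ⟨y, (hold y).symm⟩
    | new z d => exact .inr ⟨d.1, by rw [← hpnew z d, hpoint]⟩
  · rintro (⟨y, rfl⟩ | ⟨c, rfl⟩)
    · exact ⟨.old y, by rw [hrep, hold]⟩
    · exact ⟨p c, by rw [hrep, hpoint]⟩

end Embedding

end GeomExt

open GeomExt

theorem mainTheorem3 {L : Type u} [Lattice L] [IsUpperModularLattice L] [Finite L] [Nonempty L]
    {Ω : Type v} [Finite Ω] (𝒬 : Set (Set Ω))
    (hempty : ∅ ∈ 𝒬) (hsingle : ∀ a : Ω, {a} ∈ 𝒬)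
    (hgeom : GeomExt.IsFiniteGeometric 𝒬)
    (hemb : GeomExt.CoverPreservingEmbeds 𝒬 L)
    (hlen : Order.krullDim L = Order.krullDim 𝒬) :
    𝒬 ∈ GeomExt.outputsM L Ω := by
  have hQ := isFlatFamily hempty hsingle hgeom
  have hJ := hgeom.semimodular.coversJoin hgeom.lattice
  obtain ⟨f, hinj, hsup, hinf, hcov⟩ := hemb
  obtain ⟨b, hb⟩ : ∃ b : L, IsBot b := by
    obtain ⟨b, -, hb⟩ := (Set.toFinite (Set.univ : Set L)).exists_minimal Set.univ_nonempty
    exact ⟨b, fun a => (hb trivial inf_le_left).trans (inf_le_right (b := a))⟩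
  obtain ⟨t, ht⟩ : ∃ t : L, IsTop t := by
    obtain ⟨t, -, ht⟩ := (Set.toFinite (Set.univ : Set L)).exists_maximal Set.univ_nonempty
    exact ⟨t, fun a => le_trans (le_sup_right (a := t)) (ht trivial le_sup_left)⟩
  have hmono : StrictMono f := Monotone.strictMono_of_injective (fun a c h => by
    have := (hsup a c).1 (Set.mem_insert _ _)
    rwa [sup_eq_right.2 h] at this) hinj
  have hinf' : ∀ a c, (f (a ⊓ c) : Set Ω) = (f a : Set Ω) ∩ f c := fun a c => by
    have hI := hQ.inter_mem _ (f a).2 _ (f c).2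
    refine Set.Subset.antisymm (Set.subset_inter ((hinf a c).1 (Set.mem_insert _ _))
      ((hinf a c).1 (Set.mem_insert_of_mem _ rfl))) ?_
    have : (⟨_, hI⟩ : 𝒬) ≤ f (a ⊓ c) := (hinf a c).2 (by
      rintro W (rfl | rfl)
      · exact Set.inter_subset_left
      · exact Set.inter_subset_right)
    exact this
  obtain ⟨m, hm⟩ := exists_height_eq t
  have hLm : Order.krullDim L = m := by
    let _ : OrderTop L := { top := t, le_top := ht }
    rw [← Order.height_top_eq_krullDim]
    exact_mod_cast hm
  have hQm : rk 𝒬 Set.univ = m := by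
    let _ : OrderTop 𝒬 := { top := ⟨Set.univ, hQ.univ_mem⟩, le_top := fun W => Set.subset_univ _ }
    have h1 : (Order.height (⊤ : 𝒬) : WithBot ℕ∞) = m := by
      rw [Order.height_top_eq_krullDim, ← hlen, hLm]
    have h2 : Order.height (⊤ : 𝒬) = m := by exact_mod_cast h1
    rw [height_eq_rk] at h2
    exact_mod_cast h2
  have hbot := isBot_empty hempty
  -- The image of a maximal chain of `L` already has length `m`, so extending it down to `∅` and up
  -- to `Ω` adds nothing.
  obtain ⟨hfb, hft⟩ : (f b : Set Ω) = ∅ ∧ (f t : Set Ω) = Set.univ := by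
    obtain ⟨n₁, h₁⟩ := exists_coverChain (hbot (f b))
    have h₂ := (coverChain_of_height_eq hb hm).map hcov
    obtain ⟨n₃, h₃⟩ := exists_coverChain
      (show f t ≤ ⟨Set.univ, hQ.univ_mem⟩ from Set.subset_univ _)
    have h := ((h₁.trans h₂).trans h₃).height_eq hJ hbot
    rw [height_eq_rk, hQm, Nat.cast_inj] at h
    obtain rfl : n₁ = 0 := by lia
    obtain rfl : n₃ = 0 := by lia
    exact ⟨by rw [← h₁.eq_of_zero], by rw [h₃.eq_of_zero]⟩
  have hfb' : f b = ⟨∅, hempty⟩ := Subtype.ext hfb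
  have hrk : ∀ y, Order.height y = rk 𝒬 (f y) := fun y => by
    obtain ⟨n, hn⟩ := exists_height_eq y
    have h := (coverChain_of_height_eq hb hn).map hcov
    rw [hfb'] at h
    rw [hn, ← height_eq_rk, h.height_eq hJ hbot]
  have hatom : ∀ a, b ⋖ a → ∃ c, (f a : Set Ω) = {c} := fun a h =>
    (mem_atoms_iff hempty hsingle).1 ⟨_, hfb' ▸ hbot, hcov b a h⟩
  obtain ⟨F, e, hF⟩ := exists_standardForm (f := fun y => (f y : Set Ω))
    (Subtype.val_injective.comp hinj) hinf' hb hfb hft hatom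
  have hsub : setRep e ⊆ 𝒬 := by
    rw [hF]
    rintro S (⟨y, rfl⟩ | ⟨c, rfl⟩)
    · exact (f y).2
    · exact hsingle c
  have hmem : ∀ y, (f y : Set Ω) ∈ setRep e := fun y => hF ▸ .inl ⟨y, rfl⟩
  have hmem' : ∀ c, {c} ∈ setRep e := fun c => hF ▸ .inr ⟨c, rfl⟩
  have hmem0 : ∅ ∈ setRep e := hfb ▸ hmem b
  have hR : IsRankedSubfamily 𝒬 (setRep e) := by
    refine ⟨hsub, hmem0, hmem', hft ▸ hmem t, fun X hX =>
      (rk_le_rk_of_subset hsub hX).antisymm ?_⟩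
    have hX' := hX
    rw [hF] at hX'
    rcases hX' with ⟨y, rfl⟩ | ⟨c, rfl⟩
    -- The image of `L` lies in the representation, so the rank there is at least the height in `L`,
    -- which is the rank in `𝒬`.
    · have h := Order.height_le_height_apply_of_strictMono
        (fun y => (⟨f y, hmem y⟩ : setRep e)) (fun _ _ h => hmono h) y
      rw [hrk, height_eq_rk] at h
      exact_mod_cast h
    · have h1 := ((CoverChain.refl _).snoc (empty_covBy_singleton hempty (hsingle c))).height_eq
        hJ hbot
      rw [height_eq_rk] at h1
      have h2 := rk_lt hmem0 (hmem' c) Set.empty_ssubset_singleton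
      have h3 : rk 𝒬 {c} = 0 + 1 := by exact_mod_cast h1
      simp only
      lia
  obtain ⟨R, k, t', hrun⟩ := hR.exists_run hQ hQm ∅ 0
  exact ⟨⟨F, e, m, hLm, R, k, t', hrun⟩, condM_of_isFlatFamily hQ⟩
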